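/- Let $\mathbb{C}[z]\subset\mathbb{C}(z)$ be the polynomials and rational functions in $z$. For $\lambda\in\mathbb{C}$, a linear subspace $V_\lambda\subseteq\mathbb{C}[z]$ is called $\lambda$-primary if $(z-\lambda)^N\mathbb{C}[z]\subseteq V_\lambda$ for some $N\ge 0$. The adelic Grassmannian $\mathrm{Gr}^{\mathrm{ad}}$ is the set of all subspaces of $\mathbb{C}(z)$ of the form $$W=\prod_\lambda (z-\lambda)^{-k_\lambda}\,\bigcap_\lambda V_\lambda ,$$ where each $V_\lambda$ is $\lambda$-primary, $V_\lambda=\mathbb{C}[z]$ for all but finitely many $\lambda$, and $k_\lambda=\dim_{\mathbb{C}}\mathbb{C}[z]/V_\lambda$. For $W\in\mathrm{Gr}^{\mathrm{ad}}$ put $$A_W=\{f\in\mathbb{C}[z]: fW\subseteq W\},\qquad \mathcal{D}(W)=\{D\in\mathbb{C}(z)[\partial_z]: D.W\subseteq W\}.$$ For a subalgebra $\mathcal{D}$ of $\mathbb{C}(z)[\partial_z]$ let $\mathcal{D}_k$ be the space of its elements of order at most $k$ in $\partial_z$, and let $\mathrm{gr}_\partial\mathcal{D}=\bigoplus_{k\ge0}\mathcal{D}_k/\mathcal{D}_{k-1}$,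 regarded as a subspace of $\mathbb{C}(z)[\zeta]$ by sending an operator $a(z)\partial_z^k+(\text{lower order terms})$ of order $k$ to its symbol $a(z)\zeta^k$. An abelian subalgebra $B$ of an algebra $\mathcal{D}$ is called a mad subalgebra if it equals its own commutant in $\mathcal{D}$ and for every $a\in\mathcal{D}$ there is a $k$ such that $[b_0,[b_1,\dots,[b_k,a]\dots]]=0$ for all $b_0,\dots,b_k\in B$. **Proposition.** For every $W\in\mathrm{Gr}^{\mathrm{ad}}$ the pair $(\mathcal{D}(W),A_W)$ satisfies the finiteness condition, with respect to the coordinates $(z,\partial_z)$. That is: $A_W$ (acting by multiplication) is a mad subalgebra of $\mathcal{D}(W)$; the integral closure of $A_W$ in its field of fractions is $\mathbb{C}[z]$; $\mathrm{gr}_\partial\mathcal{D}(W)\subseteq\mathbb{C}[z,\zeta]$; and $\mathrm{gr}_\partial\mathcal{D}(W)$ has finite codimension in $\mathbb{C}[z,\zeta]$. -/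

import Mathlib

open Polynomial

noncomputable section

namespace AdelicGr

/-- The field `ℂ(z)` of rational functions. -/
abbrev K : Type := RatFunc ℂ

/-- The inclusion `ℂ[z] ⊆ ℂ(z)`. -/
def incl : ℂ[X] →ₐ[ℂ] K := IsScalarTower.toAlgHom ℂ ℂ[X] K

lemma incl_ne_zero {p : ℂ[X]} (hp : p ≠ 0) : incl p ≠ 0 := by
  intro h
  exact hp ((RatFunc.algebraMap_injective ℂ) (by simpa [incl] using h))

/-! ### The derivation `∂_z = d/dz` of `ℂ(z)` -/

/-- The quotient rule `(p/q)' = (p' q - p q') / q²`, with `p/q` in lowest terms. -/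
def derivFun (f : K) : K :=
  incl (derivative f.num * f.denom - f.num * derivative f.denom) / incl f.denom ^ 2

lemma num_div_denom' (f : K) : incl f.num / incl f.denom = f := by
  simp [incl]

/-- The quotient rule holds for every way of writing `f` as a fraction. -/
lemma derivFun_div (p q : ℂ[X]) (hq : q ≠ 0) :
    derivFun (incl p / incl q) = incl (derivative p * q - p * derivative q) / incl q ^ 2 := by
  set f : K := incl p / incl q with hf
  have hd : f.denom ≠ 0 := f.denom_ne_zero
  have hq' := incl_ne_zero hq
  have hd' := incl_ne_zero hd
  have h1 : incl f.num * incl q = incl p * incl f.denom := by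
    have h := num_div_denom' f
    rw [hf] at h
    rw [← hf] at h
    rwa [hf, div_eq_div_iff hd' hq'] at h
  have h2 : f.num * q = p * f.denom := by
    have : incl (f.num * q) = incl (p * f.denom) := by simpa using h1
    exact RatFunc.algebraMap_injective ℂ (by simpa [incl] using this)
  have h3 : derivative f.num * q + f.num * derivative q
      = derivative p * f.denom + p * derivative f.denom := by
    simpa [derivative_mul] using congrArg derivative h2
  have h4 : (derivative f.num * f.denom - f.num * derivative f.denom) * q ^ 2
      = (derivative p * q - p * derivative q) * f.denom ^ 2 := by
    linear_combination (q * f.denom) * h3 -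
      (q * derivative f.denom + f.denom * derivative q) * h2
  have h5 := congrArg incl h4
  simp only [derivFun]
  rw [div_eq_div_iff (pow_ne_zero 2 hd') (pow_ne_zero 2 hq')]
  simpa only [map_mul, map_pow] using h5

lemma exists_frac (f : K) : ∃ p q : ℂ[X], q ≠ 0 ∧ f = incl p / incl q :=
  ⟨f.num, f.denom, f.denom_ne_zero, (num_div_denom' f).symm⟩

lemma derivFun_add (f g : K) : derivFun (f + g) = derivFun f + derivFun g := by
  obtain ⟨p, q, hq, rfl⟩ := exists_frac f
  obtain ⟨r, s, hs, rfl⟩ := exists_frac g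
  have hq' := incl_ne_zero hq
  have hs' := incl_ne_zero hs
  have e : incl p / incl q + incl r / incl s = incl (p * s + q * r) / incl (q * s) := by
    rw [div_add_div _ _ hq' hs']; simp
  rw [e, derivFun_div _ _ (mul_ne_zero hq hs), derivFun_div _ _ hq, derivFun_div _ _ hs]
  simp only [derivative_mul, map_add, map_sub, map_mul]
  field_simp
  ring

lemma derivFun_mul (f g : K) : derivFun (f * g) = f * derivFun g + g * derivFun f := by
  obtain ⟨p, q, hq, rfl⟩ := exists_frac f
  obtain ⟨r, s, hs, rfl⟩ := exists_frac g
  have hq' := incl_ne_zero hq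
  have hs' := incl_ne_zero hs
  have e : incl p / incl q * (incl r / incl s) = incl (p * r) / incl (q * s) := by
    rw [div_mul_div_comm]; simp
  rw [e, derivFun_div _ _ (mul_ne_zero hq hs), derivFun_div _ _ hq, derivFun_div _ _ hs]
  simp only [derivative_mul, map_add, map_sub, map_mul]
  field_simp
  ring

lemma derivFun_const (c : ℂ) : derivFun (algebraMap ℂ K c) = 0 := by
  have e : algebraMap ℂ K c = incl (C c) / incl 1 := by
    rw [map_one, div_one]
    exact (incl.commutes c).symm
  rw [e, derivFun_div _ _ one_ne_zero]
  simp

/-- The operator `∂_z` on `ℂ(z)`. -/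
def dz : Module.End ℂ K where
  toFun := derivFun
  map_add' := derivFun_add
  map_smul' c f := by
    rw [Algebra.smul_def, derivFun_mul, derivFun_const, mul_zero, add_zero, RingHom.id_apply,
      Algebra.smul_def]

/-- Multiplication by a rational function, as an operator on `ℂ(z)`. -/
def mulOp : K →ₐ[ℂ] Module.End ℂ K := Algebra.lmul ℂ K

/-! ### The adelic Grassmannian -/

/-- `V` is an `a`-primary subspace of `ℂ[z]`: `(z - a)^N ℂ[z] ⊆ V` for some `N`. -/
def IsPrimaryAt (a : ℂ) (V : Submodule ℂ ℂ[X]) : Prop :=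
  ∃ N : ℕ, ∀ g : ℂ[X], (X - C a) ^ N * g ∈ V

/-- The adelic Grassmannian: all subspaces `W = ∏ (z - a)^(-k_a) V` of `ℂ(z)` with
`V = ⋂ V_a`, where each `V_a` is `a`-primary of codimension `k_a` and all but finitely many
`V_a` are equal to `ℂ[z]`. -/
def GrAd : Set (Submodule ℂ K) :=
  {W | ∃ V : ℂ → Submodule ℂ ℂ[X],
    (∀ a, IsPrimaryAt a (V a)) ∧ {a | V a ≠ ⊤}.Finite ∧
    W = ((⨅ a, V a).map incl.toLinearMap).map
      (mulOp (∏ᶠ a, incl (X - C a) ^ Module.finrank ℂ (ℂ[X] ⧸ V a))⁻¹)}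

/-- `A_W = {f ∈ ℂ[z] : f W ⊆ W}`. -/
def AW (W : Submodule ℂ K) : Subalgebra ℂ ℂ[X] where
  carrier := {f | ∀ w ∈ W, incl f * w ∈ W}
  mul_mem' {f g} hf hg w hw := by
    rw [map_mul, mul_assoc]
    exact hf _ (hg _ hw)
  add_mem' {f g} hf hg w hw := by
    rw [map_add, add_mul]
    exact W.add_mem (hf _ hw) (hg _ hw)
  algebraMap_mem' c w hw := by
    rw [AlgHom.commutes, ← Algebra.smul_def]
    exact W.smul_mem c hw

/-! ### Differential operators with rational coefficients -/

/-- The algebra `ℂ(z)[∂_z]`, acting on `ℂ(z)`: it is generated by the multiplication operators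
and `∂_z`. -/
def ratDiffOps : Subalgebra ℂ (Module.End ℂ K) :=
  Algebra.adjoin ℂ (Set.range mulOp ∪ {dz})

/-- `𝒟(W) = {D ∈ ℂ(z)[∂_z] : D.W ⊆ W}`. -/
def DW (W : Submodule ℂ K) : Subalgebra ℂ (Module.End ℂ K) where
  carrier := {D | D ∈ ratDiffOps ∧ ∀ w ∈ W, D w ∈ W}
  mul_mem' {D E} hD hE := ⟨ratDiffOps.mul_mem hD.1 hE.1, fun w hw => hD.2 _ (hE.2 w hw)⟩
  add_mem' {D E} hD hE :=
    ⟨ratDiffOps.add_mem hD.1 hE.1, fun w hw => W.add_mem (hD.2 w hw) (hE.2 w hw)⟩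
  algebraMap_mem' c := ⟨ratDiffOps.algebraMap_mem c, fun w hw => by
    simpa [Module.algebraMap_end_apply] using W.smul_mem c hw⟩

/-- The differential operator `∑_{i ≤ k} f_i ∂_z^i`. -/
def opOfCoeffs (k : ℕ) (f : ℕ → K) : Module.End ℂ K :=
  ∑ i ∈ Finset.range (k + 1), mulOp (f i) * dz ^ i

/-! ### The associated graded space -/

/-- `gr_∂ 𝒟`, embedded in `ℂ(z)[ζ]` by the symbol map. Its component of degree `k` is
`𝒟_k / 𝒟_{k-1}`, embedded as the space of all `a ζ^k` such that `𝒟` has an element of the form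
`a ∂_z^k + (terms of lower order)`; here the outer polynomial variable is `ζ`. -/
def gr (D : Subalgebra ℂ (Module.End ℂ K)) : Submodule ℂ K[X] where
  carrier := {p | ∀ k, ∃ f : ℕ → K, f k = p.coeff k ∧ opOfCoeffs k f ∈ D}
  add_mem' {p q} hp hq k := by
    obtain ⟨f, hf, hfD⟩ := hp k
    obtain ⟨g, hg, hgD⟩ := hq k
    refine ⟨f + g, by simp [hf, hg], ?_⟩
    have : opOfCoeffs k (f + g) = opOfCoeffs k f + opOfCoeffs k g := by
      simp [opOfCoeffs, add_mul, Finset.sum_add_distrib]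
    rw [this]
    exact D.add_mem hfD hgD
  zero_mem' k := ⟨0, by simp, by simp [opOfCoeffs]⟩
  smul_mem' c p hp k := by
    obtain ⟨f, hf, hfD⟩ := hp k
    refine ⟨c • f, by simp [hf], ?_⟩
    have : opOfCoeffs k (c • f) = c • opOfCoeffs k f := by
      simp [opOfCoeffs, Finset.smul_sum]
    rw [this]
    exact D.smul_mem hfD c

/-- The inclusion `ℂ[z, ζ] = ℂ[z][ζ] ⊆ ℂ(z)[ζ]`. -/
def polyIncl : ℂ[X][X] →ₐ[ℂ] K[X] := Polynomial.mapAlgHom incl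

/-! ### Mad subalgebras and the finiteness condition -/

/-- `a ∈ N_k(B)`: all iterated commutators `[b₀, [b₁, …, [b_k, a]…]]` with `b_i ∈ B` vanish. -/
def InAdFiltration {E : Type*} [Ring E] [Algebra ℂ E] (B : Subalgebra ℂ E) : ℕ → E → Prop
  | 0, a => ∀ b ∈ B, b * a - a * b = 0
  | k + 1, a => ∀ b ∈ B, InAdFiltration B k (b * a - a * b)

/-- `B` is a mad subalgebra of `D` (both inside an algebra `E`): it acts ad-nilpotently on `D`,
and it equals its own commutant in `D`. -/
structure IsMad {E : Type*} [Ring E] [Algebra ℂ E] (D B : Subalgebra ℂ E) : Prop where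
  le : B ≤ D
  adNilpotent : ∀ a ∈ D, ∃ k, InAdFiltration B k a
  commutant : ∀ a ∈ D, (∀ b ∈ B, b * a = a * b) ↔ a ∈ B

/-- The coordinate `z` is a framing of `B ⊆ ℂ(z)`: the integral closure of `B` in its field of
fractions is `ℂ[z]`. -/
def IsFramedByZ (B : Subalgebra ℂ K) : Prop :=
  ∀ f : K, ((∃ a ∈ B, ∃ b ∈ B, b ≠ 0 ∧ f = a / b) ∧ IsIntegral B f) ↔ f ∈ incl.range

/-- The finiteness condition on a pair `(D, B)`, where `B` is a mad subalgebra of `D` with fat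
framing `(z, ∂_z)`: the space `gr_∂ D` is contained in `ℂ[z, ζ]` and has finite codimension
there. -/
structure FinitenessCondition (D : Subalgebra ℂ (Module.End ℂ K)) (B : Subalgebra ℂ K) :
    Prop where
  mad : IsMad D (B.map mulOp)
  framing : IsFramedByZ B
  gr_le : gr D ≤ LinearMap.range polyIncl.toLinearMap
  finite_codim : FiniteDimensional ℂ (ℂ[X][X] ⧸ (gr D).comap polyIncl.toLinearMap)

end AdelicGr

end

open Polynomial

noncomputable section

namespace AdelicGr

/-! ### Operators with a prescribed leading term -/

/-! Write `W = q⁻¹V` with `p ℂ[z] ⊆ V ⊆ ℂ[z]` and `p ≠ 0`. Everything except finite codimension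
follows from these inclusions. Since `p ℂ[z] ⊆ A_W`, an operator commuting with `A_W` is
`ℂ(z)`-linear, hence a multiplication; commutators with functions lower the order, which gives
ad-nilpotency; and `A_W` has fraction field `ℂ(z)` and integral closure `ℂ[z]`. If `D ∈ 𝒟(W)` has
leading coefficient `a`, then `q Dⁿ q⁻¹ p` preserves `ℂ[z]`, so `aⁿ p` is a polynomial for every
`n`, which forces `a` to be one (`mem_range_incl_of_pow`).

For finite codimension, `p g ∂^k` maps `ℂ[z]` into `V`, so multiples of `p` occur as symbols in
every order. It remains to realise every `c ζⁿ` for large `n`. Let `V` be primary at one point, `t =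
z - λ`, `t^N ℂ[z] ⊆ V`, `k` the codimension of `V` and `r = N - k`. There are an operator `ℂ[z] → V`
with leading term `t^k ∂^k` (`hasOp_top_of_finrank`) and an operator `V → ℂ[z]` with leading term
`t^(-k) ∂^r` (from `hasOp_of_finrank`). Inserting `c ∂^(n-N)` between them gives leading term `c
∂ⁿ`. Bézout weights glue different points (`HasOp.inf`), and conjugation by `q` does not change
symbols. -/

/-- `D = a ∂^k + (lower order terms)`. -/
def HasSymbol (k : ℕ) (a : K) (D : Module.End ℂ K) : Prop :=
  ∃ f : ℕ → K, f k = a ∧ D = opOfCoeffs k f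

lemma dz_mul_mulOp (g : K) : dz * mulOp g = mulOp g * dz + mulOp (dz g) := by
  ext f
  change derivFun (g * f) = g * derivFun f + derivFun g * f
  rw [derivFun_mul, mul_comm f]

lemma opOfCoeffs_succ (k : ℕ) (f : ℕ → K) :
    opOfCoeffs (k + 1) f = opOfCoeffs k f + mulOp (f (k + 1)) * dz ^ (k + 1) :=
  Finset.sum_range_succ _ _

lemma opOfCoeffs_congr {k : ℕ} {f g : ℕ → K} (h : ∀ i ≤ k, f i = g i) :
    opOfCoeffs k f = opOfCoeffs k g :=
  Finset.sum_congr rfl fun i hi => by rw [h i (Nat.lt_succ_iff.mp (Finset.mem_range.mp hi))]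

lemma hasSymbol_mulOp (g : K) : HasSymbol 0 g (mulOp g) :=
  ⟨fun _ => g, rfl, by simp [opOfCoeffs]⟩

namespace HasSymbol

variable {k l : ℕ} {a b : K} {D E : Module.End ℂ K}

lemma add (hD : HasSymbol k a D) (hE : HasSymbol k b E) : HasSymbol k (a + b) (D + E) := by
  obtain ⟨f, rfl, rfl⟩ := hD
  obtain ⟨g, rfl, rfl⟩ := hE
  exact ⟨f + g, rfl, by simp [opOfCoeffs, add_mul, Finset.sum_add_distrib]⟩

lemma mulOp_mul (hD : HasSymbol k a D) (g : K) : HasSymbol k (g * a) (mulOp g * D) := by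
  obtain ⟨f, rfl, rfl⟩ := hD
  exact ⟨fun i => g * f i, rfl, by simp [opOfCoeffs, Finset.mul_sum, mul_assoc]⟩

/-- The leading coefficient may be zero, so `k` is only a bound on the order; this padding lets
lower order terms be absorbed in sums. -/
lemma succ (hD : HasSymbol k a D) : HasSymbol (k + 1) 0 D := by
  obtain ⟨f, rfl, rfl⟩ := hD
  refine ⟨fun i => if i = k + 1 then 0 else f i, by simp, ?_⟩
  rw [opOfCoeffs_succ]
  simp only [if_true, map_zero, zero_mul, add_zero]
  exact opOfCoeffs_congr fun i hi => by rw [if_neg (by omega)]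

lemma dz_mul (hD : HasSymbol k a D) : HasSymbol (k + 1) a (dz * D) := by
  obtain ⟨f, rfl, rfl⟩ := hD
  have h1 : HasSymbol (k + 1) (f k) (opOfCoeffs k f * dz) := by
    refine ⟨fun i => if i = 0 then 0 else f (i - 1), by simp, ?_⟩
    rw [opOfCoeffs, opOfCoeffs, Finset.sum_range_succ' _ (k + 1), Finset.sum_mul]
    simp [pow_succ, mul_assoc]
  have h2 : HasSymbol k (dz (f k)) (opOfCoeffs k fun i => dz (f i)) := ⟨_, rfl, rfl⟩
  have h3 := h1.add h2.succ
  have e : dz * opOfCoeffs k f = opOfCoeffs k f * dz + opOfCoeffs k fun i => dz (f i) := by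
    simp only [opOfCoeffs, Finset.mul_sum, Finset.sum_mul, ← Finset.sum_add_distrib]
    refine Finset.sum_congr rfl fun i _ => ?_
    rw [← mul_assoc, dz_mul_mulOp, add_mul, mul_assoc, mul_assoc, ← pow_succ, ← pow_succ']
  rwa [e, ← add_zero (f k)]

lemma dz_pow_mul (hD : HasSymbol k a D) (n : ℕ) : HasSymbol (n + k) a (dz ^ n * D) := by
  induction n with
  | zero => simpa using hD
  | succ n ih =>
    rw [pow_succ', mul_assoc, Nat.add_right_comm]
    exact ih.dz_mul

lemma mul (hD : HasSymbol k a D) (hE : HasSymbol l b E) :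
    HasSymbol (k + l) (a * b) (D * E) := by
  obtain ⟨f, rfl, rfl⟩ := hD
  induction k with
  | zero => simpa [opOfCoeffs] using hE.mulOp_mul (f 0)
  | succ k ih =>
    have h1 := (hE.dz_pow_mul (k + 1)).mulOp_mul (f (k + 1))
    rw [Nat.add_right_comm] at h1
    have h := ih.succ.add h1
    rw [zero_add] at h
    rwa [opOfCoeffs_succ, add_mul, mul_assoc, Nat.add_right_comm]

lemma mul_mulOp (hD : HasSymbol k a D) (g : K) : HasSymbol k (a * g) (D * mulOp g) :=
  hD.mul (hasSymbol_mulOp g)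

lemma pow (hD : HasSymbol k a D) (n : ℕ) : HasSymbol (n * k) (a ^ n) (D ^ n) := by
  induction n with
  | zero => simpa using hasSymbol_mulOp 1
  | succ n ih =>
    rw [pow_succ, pow_succ, Nat.succ_mul]
    exact ih.mul hD

lemma exists_of_le (hD : HasSymbol k a D) (h : k ≤ l) : ∃ b : K, HasSymbol l b D := by
  induction l, h using Nat.le_induction with
  | base => exact ⟨a, hD⟩
  | succ l _ ih => exact ⟨0, ih.choose_spec.succ⟩

lemma mem_ratDiffOps (hD : HasSymbol k a D) : D ∈ ratDiffOps := by
  obtain ⟨f, -, rfl⟩ := hD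
  exact ratDiffOps.sum_mem fun i _ => ratDiffOps.mul_mem
    (Algebra.subset_adjoin (Or.inl ⟨_, rfl⟩))
    (ratDiffOps.pow_mem (Algebra.subset_adjoin (Or.inr rfl)) _)

/-- The commutator with a function lowers the order. -/
lemma commutator (hD : HasSymbol (k + 1) a D) (g : K) :
    HasSymbol k ((k + 1 : K) * a * dz g) (D * mulOp g - mulOp g * D) := by
  -- Left coefficients commute with `g`, so only powers of `∂` matter; their commutators follow from
  -- the Leibniz rule by induction.
  have key : ∀ n : ℕ, HasSymbol n ((n + 1 : K) * dz g)
      (dz ^ (n + 1) * mulOp g - mulOp g * dz ^ (n + 1)) := by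
    intro n
    induction n with
    | zero =>
      have := hasSymbol_mulOp (dz g)
      simpa [dz_mul_mulOp] using this
    | succ n ih =>
      have h1 : HasSymbol (n + 1) (dz g) (mulOp (dz g) * dz ^ (n + 1)) := by
        simpa using ((hasSymbol_mulOp 1).dz_pow_mul (n + 1)).mulOp_mul (dz g)
      have e : dz ^ (n + 1 + 1) * mulOp g - mulOp g * dz ^ (n + 1 + 1)
          = dz * (dz ^ (n + 1) * mulOp g - mulOp g * dz ^ (n + 1))
            + mulOp (dz g) * dz ^ (n + 1) := by
        have h2 : mulOp (dz g) = dz * mulOp g - mulOp g * dz := by rw [dz_mul_mulOp]; abel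
        rw [h2]
        simp only [pow_succ' dz (n + 1), mul_sub, sub_mul, mul_assoc]
        abel
      rw [e]
      convert ih.dz_mul.add h1 using 1
      push_cast
      ring
  obtain ⟨f, rfl, rfl⟩ := hD
  induction k with
  | zero =>
    have h := (key 0).mulOp_mul (f 1)
    have e : opOfCoeffs (0 + 1) f * mulOp g - mulOp g * opOfCoeffs (0 + 1) f
        = mulOp (f 1) * (dz ^ (0 + 1) * mulOp g - mulOp g * dz ^ (0 + 1)) := by
      have c0 : mulOp (f 0) * mulOp g = mulOp g * mulOp (f 0) := by
        rw [← map_mul, ← map_mul, mul_comm]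
      have c1 : mulOp (f 1) * mulOp g = mulOp g * mulOp (f 1) := by
        rw [← map_mul, ← map_mul, mul_comm]
      simp only [opOfCoeffs, zero_add, Finset.sum_range_succ, Finset.range_zero,
        Finset.sum_empty, pow_zero, mul_one, pow_one, add_mul, mul_add, mul_sub, c0]
      rw [← mul_assoc (mulOp g), ← c1]
      simp only [mul_assoc]
      abel
    rw [e]
    convert h using 1
    push_cast
    ring
  | succ k ih =>
    have h := ih.succ.add ((key (k + 1)).mulOp_mul (f (k + 1 + 1)))
    have e : opOfCoeffs (k + 1 + 1) f * mulOp g - mulOp g * opOfCoeffs (k + 1 + 1) f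
        = (opOfCoeffs (k + 1) f * mulOp g - mulOp g * opOfCoeffs (k + 1) f)
          + mulOp (f (k + 1 + 1)) *
            (dz ^ (k + 1 + 1) * mulOp g - mulOp g * dz ^ (k + 1 + 1)) := by
      have c1 : mulOp (f (k + 1 + 1)) * mulOp g = mulOp g * mulOp (f (k + 1 + 1)) := by
        rw [← map_mul, ← map_mul, mul_comm]
      rw [opOfCoeffs_succ]
      simp only [add_mul, mul_add, mul_sub]
      rw [← mul_assoc (mulOp g) (mulOp _), ← c1]
      simp only [mul_assoc]
      abel
    rw [e]
    convert h using 1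
    push_cast
    ring

/-- Each commutator with a function lowers the order by one, and operators of order zero are
themselves multiplications. -/
lemma inAdFiltration (hD : HasSymbol k a D) {B : Subalgebra ℂ (Module.End ℂ K)}
    (hB : ∀ b ∈ B, ∃ g, mulOp g = b) : InAdFiltration B k D := by
  induction k generalizing a D with
  | zero =>
    intro b hb
    obtain ⟨g, rfl⟩ := hB b hb
    obtain ⟨f, -, rfl⟩ := hD
    simp only [opOfCoeffs, zero_add, Finset.range_one, Finset.sum_singleton, pow_zero, mul_one]
    rw [← map_mul, ← map_mul, mul_comm, sub_self]
  | succ k ih =>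
    intro b hb
    obtain ⟨g, rfl⟩ := hB b hb
    have h := (hD.commutator g).mulOp_mul (-1)
    have e : mulOp (-1) * (D * mulOp g - mulOp g * D) = mulOp g * D - D * mulOp g := by
      rw [map_neg, map_one, neg_mul, one_mul, neg_sub]
    rw [e] at h
    exact ih h

end HasSymbol

lemma exists_hasSymbol {D : Module.End ℂ K} (hD : D ∈ ratDiffOps) : ∃ (k : ℕ) (a : K), HasSymbol k a D := by
  induction hD using Algebra.adjoin_induction with
  | mem x hx =>
    rcases hx with ⟨g, rfl⟩ | rfl
    · exact ⟨0, g, hasSymbol_mulOp g⟩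
    · exact ⟨1, 1, by simpa using (hasSymbol_mulOp 1).dz_mul⟩
  | algebraMap c => exact ⟨0, algebraMap ℂ K c, by
    rw [← AlgHom.commutes mulOp]; exact hasSymbol_mulOp _⟩
  | add x y _ _ hx hy =>
    obtain ⟨k, a, hx⟩ := hx
    obtain ⟨l, b, hy⟩ := hy
    obtain ⟨a', hx'⟩ := hx.exists_of_le (le_max_left k l)
    obtain ⟨b', hy'⟩ := hy.exists_of_le (le_max_right k l)
    exact ⟨_, _, hx'.add hy'⟩
  | mul x y _ _ hx hy =>
    obtain ⟨k, a, hx⟩ := hx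
    obtain ⟨l, b, hy⟩ := hy
    exact ⟨_, _, hx.mul hy⟩

/-- An operator that preserves `ℂ[z]` has a polynomial leading coefficient. -/
lemma HasSymbol.mem_range_incl {k : ℕ} {a : K} {D : Module.End ℂ K} (hD : HasSymbol k a D)
    (h : ∀ f : ℂ[X], D (incl f) ∈ incl.range) : a ∈ incl.range := by
  induction k generalizing a D with
  | zero =>
    obtain ⟨f, rfl, rfl⟩ := hD
    have := h 1
    simpa [opOfCoeffs, mulOp] using this
  | succ k ih =>
    have hz : dz (incl X) = 1 := by
      have := derivFun_div X 1 one_ne_zero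
      change derivFun (incl X) = 1
      simpa using this
    -- The commutator with `z` still preserves `ℂ[z]` and has leading coefficient `(k + 1) a`, from
    -- which `a` is recovered in characteristic zero.
    have h1 := hD.commutator (incl X)
    rw [hz, mul_one] at h1
    have h2 := ih h1 fun f => by
      have e : (D * mulOp (incl X) - mulOp (incl X) * D) (incl f)
          = D (incl (X * f)) - incl X * D (incl f) := by
        simp [mulOp]
      rw [e]
      exact sub_mem (h _) (mul_mem ⟨X, rfl⟩ (h _))
    have h3 := incl.range.smul_mem h2 ((k + 1 : ℂ)⁻¹)
    convert h3 using 1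
    have h4 : (k + 1 : ℂ) ≠ 0 := Nat.cast_add_one_ne_zero k
    have h5 : ((k + 1 : K)) * a = (k + 1 : ℂ) • a := by
      rw [Algebra.smul_def]; simp
    rw [h5, smul_smul, inv_mul_cancel₀ h4, one_smul]

/-! ### Elements of the adelic Grassmannian -/

lemma incl_injective : Function.Injective incl := fun f g h => by
  by_contra hne
  exact incl_ne_zero (sub_ne_zero.mpr hne) (by rw [map_sub, h, sub_self])

/-- `W = q⁻¹ V` with `p ℂ[z] ⊆ V ⊆ ℂ[z]`. -/
def IsLattice (W : Submodule ℂ K) (V : Submodule ℂ ℂ[X]) (q : K) (p : ℂ[X]) : Prop :=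
  q ≠ 0 ∧ p ≠ 0 ∧ (∀ w, w ∈ W ↔ ∃ v ∈ V, w = q⁻¹ * incl v) ∧ ∀ f, p * f ∈ V

/-- A rational function with bounded denominators of all its powers is a polynomial. -/
lemma mem_range_incl_of_pow {a : K} {p : ℂ[X]} (hp : p ≠ 0)
    (h : ∀ n : ℕ, a ^ n * incl p ∈ incl.range) : a ∈ incl.range := by
  have hdvd : ∀ n : ℕ, a.denom ^ n ∣ p := by
    intro n
    obtain ⟨g, hg⟩ := h n
    have hd := incl_ne_zero a.denom_ne_zero
    have e : a.num ^ n * p = g * a.denom ^ n := by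
      apply incl_injective
      have h1 : a * incl a.denom = incl a.num := ((div_eq_iff hd).mp (num_div_denom' a)).symm
      rw [map_mul, map_mul, map_pow, map_pow, ← h1, show incl g = _ from hg]
      ring
    have hc : IsCoprime (a.denom ^ n) (a.num ^ n) := (a.isCoprime_num_denom.symm).pow
    exact hc.dvd_of_dvd_mul_left (Dvd.intro_left g e.symm)
  -- Otherwise the power `deg p + 1` of the denominator would have degree larger than its multiple
  -- `p`.
  have hdeg : a.denom.natDegree = 0 := by
    by_contra hne
    have h1 := natDegree_le_of_dvd (hdvd (p.natDegree + 1)) hp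
    rw [natDegree_pow] at h1
    have : 1 ≤ a.denom.natDegree := Nat.one_le_iff_ne_zero.mpr hne
    nlinarith
  have h1 : a.denom = 1 := a.monic_denom.natDegree_eq_zero.mp hdeg
  refine ⟨a.num, ?_⟩
  have := num_div_denom' a
  rw [h1, map_one, div_one] at this
  exact this

/-! ### The clauses that need only `p ℂ[z] ⊆ V ⊆ ℂ[z]` -/

section Lattice

variable {W : Submodule ℂ K} {V : Submodule ℂ ℂ[X]} {q : K} {p : ℂ[X]}

lemma IsLattice.mem (h : IsLattice W V q p) (f : ℂ[X]) : q⁻¹ * incl (p * f) ∈ W :=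
  (h.2.2.1 _).mpr ⟨_, h.2.2.2 f, rfl⟩

lemma IsLattice.mul_mem_range (h : IsLattice W V q p) {w : K} (hw : w ∈ W) :
    q * w ∈ incl.range := by
  obtain ⟨v, -, rfl⟩ := (h.2.2.1 _).mp hw
  exact ⟨v, (mul_inv_cancel_left₀ h.1 _).symm⟩

lemma IsLattice.mul_mem_AW (h : IsLattice W V q p) (f : ℂ[X]) : p * f ∈ AW W := by
  intro w hw
  obtain ⟨v, -, rfl⟩ := (h.2.2.1 _).mp hw
  have := h.mem (f * v)
  convert this using 1
  simp only [map_mul]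
  ring

lemma IsLattice.mem_range_of_mul_mem (h : IsLattice W V q p) {g : K}
    (hg : ∀ w ∈ W, g * w ∈ W) : g ∈ incl.range := by
  refine mem_range_incl_of_pow h.2.1 fun n => ?_
  have hn : ∀ n : ℕ, g ^ n * (q⁻¹ * incl (p * 1)) ∈ W := by
    intro n
    induction n with
    | zero => simpa using h.mem 1
    | succ n ih => rw [pow_succ', mul_assoc]; exact hg _ ih
  have h1 := h.mul_mem_range (hn n)
  have hq := h.1
  convert h1 using 1
  rw [mul_one]
  field_simp

lemma IsLattice.isMad (h : IsLattice W V q p) :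
    IsMad (DW W) (((AW W).map incl).map mulOp) where
  le := by
    rintro _ ⟨_, ⟨f, hf, rfl⟩, rfl⟩
    exact ⟨(hasSymbol_mulOp _).mem_ratDiffOps, fun w hw => hf w hw⟩
  adNilpotent a ha := by
    obtain ⟨k, b, hb⟩ := exists_hasSymbol ha.1
    refine ⟨k, hb.inAdFiltration ?_⟩
    rintro _ ⟨g, -, rfl⟩
    exact ⟨g, rfl⟩
  commutant a ha := by
    constructor
    · intro hc
      have hcomm : ∀ f ∈ AW W, ∀ u : K, incl f * a u = a (incl f * u) := fun f hf u =>
        LinearMap.congr_fun (hc _ ⟨_, ⟨f, hf, rfl⟩, rfl⟩) u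
      -- For `u = r/s`, both `p s` and `p r` lie in `A_W`; moving them through `a` in `(p s) u = (p
      -- r) 1` determines `a u`.
      have hmul : ∀ u : K, a u = a 1 * u := by
        intro u
        obtain ⟨r, s, hs, rfl⟩ := exists_frac u
        have hs' := incl_ne_zero hs
        have hp' := incl_ne_zero h.2.1
        have h1 := hcomm _ (h.mul_mem_AW s) (incl r / incl s)
        have h2 := hcomm _ (h.mul_mem_AW r) 1
        have e : incl (p * s) * (incl r / incl s) = incl (p * r) * 1 := by
          simp only [map_mul]; field_simp
        rw [e, ← h2, map_mul, map_mul] at h1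
        have h3 : incl p * (incl s * a (incl r / incl s)) = incl p * (incl r * a 1) := by
          linear_combination h1
        have h4 := mul_left_cancel₀ hp' h3
        field_simp
        linear_combination h4
      have hg : ∀ w ∈ W, a 1 * w ∈ W := fun w hw => by rw [← hmul]; exact ha.2 w hw
      obtain ⟨f, hf⟩ := h.mem_range_of_mul_mem hg
      have hf' : incl f = a 1 := hf
      refine ⟨a 1, ⟨f, fun w hw => ?_, hf'⟩, ?_⟩
      · rw [hf']; exact hg w hw
      · ext u
        exact (hmul u).symm
    · rintro ⟨g, -, rfl⟩ _ ⟨f, -, rfl⟩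
      change mulOp f * mulOp g = mulOp g * mulOp f
      rw [← map_mul, ← map_mul, mul_comm]

/-- Integrality over `A_W` implies integrality over the integrally closed ring `ℂ[z]`. Conversely `g
= (p g)/p`, and `z` is integral because a nonconstant monic polynomial in `z` lies in `p ℂ[z] ⊆
A_W`. -/
lemma IsLattice.isFramedByZ (h : IsLattice W V q p) : IsFramedByZ ((AW W).map incl) := by
  set B := (AW W).map incl with hB
  have hpB : ∀ f, incl (p * f) ∈ B := fun f => ⟨_, h.mul_mem_AW f, rfl⟩
  intro f
  constructor
  · rintro ⟨-, P, hP, hPf⟩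
    have hint : IsIntegral ℂ[X] f := by
      have hle : ∀ b ∈ B, b ∈ Set.range (algebraMap ℂ[X] K) := by
        rintro _ ⟨g, -, rfl⟩
        exact ⟨g, rfl⟩
      choose! φ hφ using hle
      have hlift : (P.map (algebraMap B K)) ∈ Polynomial.lifts (algebraMap ℂ[X] K) := by
        rw [lifts_iff_coeff_lifts]
        intro n
        rw [coeff_map]
        exact ⟨_, hφ _ (P.coeff n).2⟩
      obtain ⟨Q, hQ, -, hQm⟩ := lifts_and_degree_eq_and_monic hlift (hP.map _)
      refine ⟨Q, hQm, ?_⟩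
      rw [← eval_map, hQ, eval_map]
      exact hPf
    obtain ⟨g, hg⟩ := IsIntegrallyClosed.isIntegral_iff.mp hint
    exact ⟨g, hg⟩
  · rintro ⟨g, rfl⟩
    have hp' := incl_ne_zero h.2.1
    refine ⟨⟨_, hpB g, _, hpB 1, by simpa using hp', ?_⟩, ?_⟩
    · change incl g = _
      simp only [map_mul, map_one]
      field_simp
    · have hX : IsIntegral B (incl X) := by
        -- The factor `X` keeps the degree positive when `p` is constant.
        set r : ℂ[X] := p * (C p.leadingCoeff⁻¹ * X) with hr
        have hlc : p.leadingCoeff ≠ 0 := leadingCoeff_ne_zero.mpr h.2.1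
        have hm : r.Monic := by
          rw [Monic, hr, leadingCoeff_mul, leadingCoeff_mul, leadingCoeff_C, leadingCoeff_X,
            mul_one, mul_inv_cancel₀ hlc]
        have hdeg : r.natDegree ≠ 0 := by
          rw [hr, natDegree_mul h.2.1 (mul_ne_zero (C_ne_zero.mpr (inv_ne_zero hlc)) X_ne_zero),
            natDegree_C_mul_X _ (inv_ne_zero hlc)]
          omega
        refine IsIntegral.of_aeval_monic (p := r.map (algebraMap ℂ B)) (hm.map _)
          (by rwa [hm.natDegree_map]) ?_
        have e : aeval (incl X) (r.map (algebraMap ℂ B)) = incl r := by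
          rw [aeval_map_algebraMap, aeval_algHom_apply, aeval_X_left_apply]
        rw [e]
        exact isIntegral_algebraMap (x := (⟨incl r, hpB _⟩ : B))
      change IsIntegral B (incl g)
      induction g using Polynomial.induction_on' with
      | add f g hf hg => rw [map_add]; exact hf.add hg
      | monomial n c =>
        rw [← C_mul_X_pow_eq_monomial, map_mul, map_pow]
        refine IsIntegral.mul ?_ (hX.pow n)
        have : incl (C c) = algebraMap B K (algebraMap ℂ B c) := incl.commutes c
        rw [this]
        exact isIntegral_algebraMap

/-- One operator only shows that `a p` is a polynomial. Its powers also lie in `𝒟(W)`, so the single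
`p` clears the denominators of all `aⁿ`. -/
lemma IsLattice.gr_le (h : IsLattice W V q p) :
    gr (DW W) ≤ LinearMap.range polyIncl.toLinearMap := by
  intro P hP
  have hc : ∀ k, P.coeff k ∈ incl.range := by
    intro k
    obtain ⟨f, hf, hD⟩ := hP k
    have hs : HasSymbol k (P.coeff k) (opOfCoeffs k f) := ⟨f, hf, rfl⟩
    have hq := h.1
    refine mem_range_incl_of_pow h.2.1 fun n => ?_
    have h1 := ((hs.pow n).mulOp_mul q).mul_mulOp (q⁻¹ * incl p)
    have h2 := h1.mem_range_incl fun g => by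
      have h3 := h.mul_mem_range (((DW W).pow_mem hD n).2 _ (h.mem g))
      convert h3 using 1
      simp [mulOp, mul_assoc]
    convert h2 using 1
    field_simp
  have hl : P ∈ Polynomial.lifts (incl : ℂ[X] →+* K) := by
    rw [lifts_iff_coeff_lifts]
    exact fun k => hc k
  obtain ⟨Q, hQ⟩ := (mem_lifts _).mp hl
  exact ⟨Q, hQ⟩

end Lattice

/-! ### Operators between subspaces of `ℂ[z]` -/

/-- Some operator with leading term `a ∂^k` maps `V₁` into `V₂`. -/
def HasOp (V₁ V₂ : Submodule ℂ ℂ[X]) (k : ℕ) (a : K) : Prop :=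
  ∃ D, HasSymbol k a D ∧ ∀ v ∈ V₁, ∃ w ∈ V₂, D (incl v) = incl w

lemma HasOp.comp {V₁ V₂ V₃ : Submodule ℂ ℂ[X]} {k l : ℕ} {a b : K} (hb : HasOp V₂ V₃ l b)
    (ha : HasOp V₁ V₂ k a) : HasOp V₁ V₃ (l + k) (b * a) := by
  obtain ⟨D, hD, hDV⟩ := ha
  obtain ⟨E, hE, hEV⟩ := hb
  refine ⟨E * D, hE.mul hD, fun v hv => ?_⟩
  obtain ⟨w, hw, e⟩ := hDV v hv
  obtain ⟨u, hu, e'⟩ := hEV w hw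
  exact ⟨u, hu, by rw [Module.End.mul_apply, e, e']⟩

lemma HasOp.mono_left {V₁ V₁' V₂ : Submodule ℂ ℂ[X]} {k : ℕ} {a : K} (h : HasOp V₁ V₂ k a)
    (hle : V₁' ≤ V₁) : HasOp V₁' V₂ k a := by
  obtain ⟨D, hD, hDV⟩ := h
  exact ⟨D, hD, fun v hv => hDV v (hle hv)⟩

lemma hasOp_mul (a : K) {V₁ V₂ : Submodule ℂ ℂ[X]}
    (h : ∀ v ∈ V₁, ∃ w ∈ V₂, a * incl v = incl w) : HasOp V₁ V₂ 0 a :=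
  ⟨mulOp a, hasSymbol_mulOp a, h⟩

lemma dz_incl (f : ℂ[X]) : dz (incl f) = incl (derivative f) := by
  have := derivFun_div f 1 one_ne_zero
  change derivFun (incl f) = _
  simpa using this

lemma hasSymbol_dz_add (h : K) : HasSymbol 1 1 (dz + mulOp h) := by
  have := (hasSymbol_mulOp 1).dz_mul.add (hasSymbol_mulOp h).succ
  simpa using this

lemma dz_add_apply (h f : K) : (dz + mulOp h) f = dz f + h * f := rfl

lemma hasOp_dz_pow (n : ℕ) : HasOp ⊤ ⊤ n 1 := by
  refine ⟨dz ^ n, by simpa using (hasSymbol_mulOp 1).dz_pow_mul n, fun v _ =>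
    ⟨derivative^[n] v, trivial, ?_⟩⟩
  induction n with
  | zero => rfl
  | succ n ih =>
    rw [pow_succ', Module.End.mul_apply, ih, dz_incl, Function.iterate_succ_apply']

/-- If `N + 1` is the smallest exponent for which `φ` vanishes on `(z - λ)^(N + 1) ℂ[z]`, then every
functional vanishing on `(z - λ)^(N + 1) ℂ[z]` is of the form `φ (h ·)`. -/
lemma exists_functional_mul (t : ℂ[X]) (ht : ∃ c, t = X - C c) (N : ℕ) :
    ∀ φ ψ : ℂ[X] →ₗ[ℂ] ℂ, (∃ f, φ (t ^ N * f) ≠ 0) → (∀ f, φ (t ^ (N + 1) * f) = 0) →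
      (∀ f, ψ (t ^ (N + 1) * f) = 0) → ∃ h, ∀ f, ψ f = φ (h * f) := by
  obtain ⟨c, rfl⟩ := ht
  set t : ℂ[X] := X - C c
  induction N with
  | zero =>
    intro φ ψ h0 h1 h2
    have hC : ∀ χ : ℂ[X] →ₗ[ℂ] ℂ, (∀ f, χ (t ^ (0 + 1) * f) = 0) →
        ∀ f : ℂ[X], χ f = f.eval c * χ 1 := by
      intro χ hχ f
      have e : f = t ^ (0 + 1) * (f /ₘ t) + f.eval c • (1 : ℂ[X]) := by
        rw [zero_add, pow_one, smul_eq_C_mul, mul_one, add_comm]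
        conv_lhs => rw [← modByMonic_add_div f t, modByMonic_X_sub_C_eq_C_eval]
      conv_lhs => rw [e]
      rw [map_add, hχ, zero_add, map_smul, smul_eq_mul]
    obtain ⟨f, hf⟩ := h0
    have hφ : φ 1 ≠ 0 := by
      intro h
      exact hf (by rw [hC φ h1, h, mul_zero])
    refine ⟨C (ψ 1 / φ 1), fun f => ?_⟩
    rw [hC ψ h2, hC φ h1 (_ * f), eval_mul, eval_C]
    field_simp
  | succ N ih =>
    intro φ ψ h0 h1 h2
    -- Induction matches the functionals on `t ℂ[z]`. Adding a multiple of `t ^ (N + 1)` to `h` then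
    -- corrects the value at `1` and changes nothing on `t ℂ[z]`, as `φ` kills `t ^ (N + 2) ℂ[z]`.
    obtain ⟨h, hh⟩ := ih (φ ∘ₗ LinearMap.mulLeft ℂ t) (ψ ∘ₗ LinearMap.mulLeft ℂ t)
      (by
        obtain ⟨f, hf⟩ := h0
        exact ⟨f, by simpa [pow_succ', mul_assoc] using hf⟩)
      (fun f => by simpa [pow_succ', mul_assoc] using h1 f)
      (fun f => by simpa [pow_succ', mul_assoc] using h2 f)
    have hh' : ∀ f, ψ (t * f) = φ (h * (t * f)) := by
      intro f
      have := hh f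
      simp only [LinearMap.comp_apply, LinearMap.mulLeft_apply] at this
      rw [this]
      congr 1
      ring
    have hdec : ∀ f : ℂ[X], f = t * (f /ₘ t) + f.eval c • (1 : ℂ[X]) := by
      intro f
      rw [smul_eq_C_mul, mul_one, add_comm]
      conv_lhs => rw [← modByMonic_add_div f t, modByMonic_X_sub_C_eq_C_eval]
    obtain ⟨f₀, hf₀⟩ := h0
    have hφN : φ (t ^ (N + 1)) ≠ 0 := by
      intro h
      apply hf₀
      have e : t ^ (N + 1) * f₀ = t ^ (N + 1 + 1) * (f₀ /ₘ t) + f₀.eval c • t ^ (N + 1) := by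
        conv_lhs => rw [hdec f₀]
        rw [mul_add, mul_smul_comm, mul_one]
        ring
      rw [e, map_add, h1, map_smul, h, smul_zero, add_zero]
    set e := (ψ 1 - φ h) / φ (t ^ (N + 1)) with he
    refine ⟨h + e • t ^ (N + 1), fun f => ?_⟩
    have e1 : (h + e • t ^ (N + 1)) * f = h * (t * (f /ₘ t)) + f.eval c • h
        + e • (t ^ (N + 1 + 1) * (f /ₘ t)) + (f.eval c * e) • t ^ (N + 1) := by
      conv_lhs => rw [hdec f]
      simp only [smul_eq_C_mul, C_mul]
      ring
    conv_lhs => rw [hdec f]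
    rw [e1]
    simp only [map_add, map_smul, h1, hh', smul_eq_mul, mul_zero, add_zero]
    rw [he]
    field_simp
    ring

/-! ### Construction of operators at a single point -/

section Local

variable {t : ℂ[X]}

/-- A subspace of codimension at most `k` that contains `(z - λ)^N ℂ[z]` contains the image of
`ℂ[z]` under an operator with leading term `(z - λ)^k ∂^k`. -/
lemma hasOp_top_of_finrank (ht : ∃ c, t = X - C c) (N k : ℕ) : ∀ V : Submodule ℂ ℂ[X],
    (∀ f, t ^ N * f ∈ V) → Module.Finite ℂ (ℂ[X] ⧸ V) → Module.finrank ℂ (ℂ[X] ⧸ V) ≤ k →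
      HasOp ⊤ V k (incl t ^ k) := by
  have ht' : derivative t = 1 := by obtain ⟨c, rfl⟩ := ht; simp
  induction k with
  | zero =>
    intro V hV hfin hk
    have hs : Subsingleton (ℂ[X] ⧸ V) := Module.finrank_zero_iff.mp (Nat.le_zero.mp hk)
    have : V = ⊤ := Submodule.Quotient.subsingleton_iff.mp hs
    subst this
    simpa using hasOp_dz_pow 0
  | succ k ih =>
    intro V hV hfin hk
    -- The preimage of `V` under `T = t ∂ + h` has smaller codimension as soon as `T` is not
    -- surjective modulo `V`.
    obtain ⟨h, V₁, hV₁, hfin₁, hk₁, hop⟩ : ∃ (h : ℂ[X]) (V₁ : Submodule ℂ ℂ[X]),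
        (∀ f, t ^ N * f ∈ V₁) ∧ Module.Finite ℂ (ℂ[X] ⧸ V₁) ∧
        Module.finrank ℂ (ℂ[X] ⧸ V₁) ≤ k ∧ ∀ v ∈ V₁, t * derivative v + h * v ∈ V := by
      let T : ℂ[X] → ℂ[X] →ₗ[ℂ] ℂ[X] := fun h =>
        LinearMap.mulLeft ℂ t ∘ₗ derivative + LinearMap.mulLeft ℂ h
      have hT : ∀ h v, T h v = t * derivative v + h * v := fun h v => rfl
      obtain ⟨h, hlt⟩ : ∃ h, V = ⊤ ∨ ¬ Function.Surjective (V.mkQ ∘ₗ T h) := by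
        by_cases htop : V = ⊤
        · exact ⟨0, Or.inl htop⟩
        obtain ⟨φ, hφ0, hφV⟩ := Submodule.exists_le_ker_of_lt_top V (lt_top_iff_ne_top.mpr htop)
        have hφ : ∀ v ∈ V, φ v = 0 := fun v hv => hφV hv
        have hex : ∃ n, ∀ f, φ (t ^ n * f) = 0 := ⟨N, fun f => hφ _ (hV f)⟩
        classical
        obtain ⟨d, hd⟩ : ∃ d, Nat.find hex = d + 1 := by
          refine Nat.exists_eq_succ_of_ne_zero fun h0 => hφ0 ?_
          ext1 n
          have := Nat.find_spec hex
          rw [h0] at this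
          ext
          simpa using this _
        have hd1 := Nat.find_spec hex
        rw [hd] at hd1
        have hd0 : ∃ f, φ (t ^ d * f) ≠ 0 := by
          have := Nat.find_min hex (m := d) (by omega)
          push Not at this
          exact this
        -- This `h` makes `φ ∘ T` vanish for a nonzero `φ` that kills `V`. It exists because `t ∂`
        -- preserves `t ^ (d + 1) ℂ[z]`.
        obtain ⟨h, hh⟩ := exists_functional_mul t ht d φ
          (-(φ ∘ₗ LinearMap.mulLeft ℂ t ∘ₗ derivative)) hd0 hd1 (fun f => by
            have e : t * derivative (t ^ (d + 1) * f)
                = t ^ (d + 1) * (C (d + 1 : ℂ) * f + t * derivative f) := by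
              rw [derivative_mul, derivative_pow_succ, ht']
              ring
            simp only [LinearMap.neg_apply, LinearMap.comp_apply, LinearMap.mulLeft_apply]
            rw [e, hd1, neg_zero])
        refine ⟨h, Or.inr fun hsurj => hφ0 ?_⟩
        have hz : ∀ f, φ (T h f) = 0 := by
          intro f
          rw [hT, map_add, ← hh]
          simp
        apply LinearMap.ext
        intro f
        obtain ⟨g, hg⟩ := hsurj (V.mkQ f)
        have hg' : T h g - f ∈ V := (Submodule.Quotient.eq V).mp hg
        have := hφ _ hg'
        rw [map_sub, hz, zero_sub, neg_eq_zero] at this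
        exact this
      let V₁ := V.comap (T h)
      let F : (ℂ[X] ⧸ V₁) →ₗ[ℂ] (ℂ[X] ⧸ V) := V₁.mapQ V (T h) le_rfl
      have hF : Function.Injective F := by
        rw [← LinearMap.ker_eq_bot]
        rw [Submodule.ker_mapQ]
        exact (Submodule.mkQ_map_self _)
      refine ⟨h, V₁, fun f => ?_, Module.Finite.of_injective F hF, ?_, fun v hv => hv⟩
      · change T h _ ∈ V
        rcases N with _ | n
        · simpa using hV (T h f)
        · have e : T h (t ^ (n + 1) * f)
              = t ^ (n + 1) * (C (n + 1 : ℂ) * f + t * derivative f + h * f) := by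
            rw [hT, derivative_mul, derivative_pow_succ, ht']
            ring
          rw [e]
          exact hV _
      · rcases hlt with htop | hns
        · have : V₁ = ⊤ := by simp [V₁, htop]
          have hs : Subsingleton (ℂ[X] ⧸ V₁) :=
            Submodule.Quotient.subsingleton_iff.mpr this
          rw [Module.finrank_zero_of_subsingleton]
          exact Nat.zero_le _
        · have hr : LinearMap.range F < ⊤ := by
            rw [lt_top_iff_ne_top]
            intro hr
            apply hns
            have hs := LinearMap.range_eq_top.mp hr
            intro y
            obtain ⟨x, rfl⟩ := hs y
            obtain ⟨x, rfl⟩ := V₁.mkQ_surjective x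
            exact ⟨x, rfl⟩
          have h1 := Submodule.finrank_lt hr.ne
          rw [LinearMap.finrank_range_of_inj hF] at h1
          omega
    have hop1 : HasOp V₁ V 1 (incl t) := by
      refine ⟨mulOp (incl t) * (dz + mulOp (incl h / incl t)), ?_, fun v hv =>
        ⟨_, hop v hv, ?_⟩⟩
      · simpa using (hasSymbol_dz_add _).mulOp_mul (incl t)
      · have ht0 : incl t ≠ 0 := by
          apply incl_ne_zero
          rintro rfl
          simp at ht'
        rw [Module.End.mul_apply, dz_add_apply, dz_incl]
        change incl t * _ = _
        rw [map_add, map_mul, map_mul]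
        field_simp
    have := hop1.comp (ih V₁ hV₁ hfin₁ hk₁)
    rwa [← pow_succ', Nat.add_comm] at this

/-- A finite dimensional space of polynomials is annihilated modulo high powers of `z - λ`. -/
lemma hasOp_of_finrank (ht : ∃ c, t = X - C c) (r : ℕ) : ∀ (k : ℕ) (U : Submodule ℂ ℂ[X]),
    Module.Finite ℂ U → Module.finrank ℂ U ≤ r →
      ∃ D, HasSymbol r 1 D ∧ (∀ f, ∃ w, D (incl (t ^ (k + r) * f)) = incl (t ^ k * w)) ∧
        ∀ u ∈ U, ∃ w, D (incl u) = incl (t ^ k * w) := by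
  have ht' : derivative t = 1 := by obtain ⟨c, rfl⟩ := ht; simp
  have hirr : Prime t := by obtain ⟨c, rfl⟩ := ht; exact prime_X_sub_C c
  induction r with
  | zero =>
    intro k U hfin hU
    have hs := Submodule.finrank_eq_zero.mp (Nat.le_zero.mp hU)
    refine ⟨1, by simpa using hasSymbol_mulOp 1, fun f => ⟨f, rfl⟩, fun u hu => ⟨0, ?_⟩⟩
    rw [hs, Submodule.mem_bot] at hu
    simp [hu]
  | succ r ih =>
    intro k U hfin hU
    have ht0 : incl t ≠ 0 := incl_ne_zero hirr.ne_zero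
    -- The factor `∂ + h/t` is to kill one vector `v` of `U` modulo `t ^ (k + r)`, leaving a space
    -- of dimension at most `r`. Taking `v` of minimal order in `t` makes a polynomial `h` possible.
    obtain ⟨h, U', hfin', hU', hop⟩ : ∃ (h : ℂ[X]) (U' : Submodule ℂ ℂ[X]),
        Module.Finite ℂ U' ∧ Module.finrank ℂ U' ≤ r ∧
        ∀ u ∈ U, ∃ u' ∈ U', ∃ w, t * derivative u + h * u = t * (u' + t ^ (k + r) * w) := by
      have hTd : ∀ (n : ℕ) (f : ℂ[X]),
          t * derivative (t ^ n * f) = t ^ n * (C (n : ℂ) * f + t * derivative f) := by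
        intro n f
        rcases n with _ | n
        · simp
        · rw [derivative_mul, derivative_pow_succ, ht']
          push_cast
          ring
      by_cases hall : ∀ u ∈ U, t ^ (k + r + 1) ∣ u
      · refine ⟨0, ⊥, inferInstance, by simp, fun u hu => ⟨0, Submodule.zero_mem _, ?_⟩⟩
        obtain ⟨f, rfl⟩ := hall u hu
        exact ⟨_, by rw [hTd, zero_mul, add_zero, zero_add, ← mul_assoc, ← pow_succ' t]⟩
      push Not at hall
      classical
      have hex : ∃ n, ∃ u ∈ U, ¬ t ^ (n + 1) ∣ u := ⟨_, hall⟩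
      obtain ⟨d, hd⟩ : ∃ d, d = Nat.find hex := ⟨_, rfl⟩
      obtain ⟨v, hvU, hv⟩ := Nat.find_spec hex
      rw [← hd] at hv
      have hdiv : ∀ u ∈ U, t ^ d ∣ u := by
        intro u hu
        rcases d with _ | n
        · simp
        · have := Nat.find_min hex (m := n) (by omega)
          push Not at this
          exact this u hu
      obtain ⟨g, rfl⟩ := hdiv v hvU
      have hg : ¬ t ∣ g := fun h => hv (by rw [pow_succ]; exact mul_dvd_mul_left _ h)
      have hcop : IsCoprime g (t ^ (k + r + 1)) :=
        ((hirr.irreducible.coprime_iff_not_dvd.mpr hg).symm).pow_right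
      obtain ⟨a, b, hab⟩ := hcop
      set e₀ : ℂ[X] := C (d : ℂ) * g + t * derivative g with he₀
      -- An approximation of `-t v'/v = -e₀/g`, since `a` inverts `g` modulo `t ^ (k + r + 1)`.
      let h : ℂ[X] := -(e₀ * a)
      let T : ℂ[X] →ₗ[ℂ] ℂ[X] := LinearMap.mulLeft ℂ t ∘ₗ derivative + LinearMap.mulLeft ℂ h
      have hT : ∀ v, T v = t * derivative v + h * v := fun v => rfl
      have hTv : T (t ^ d * g) = t * (t ^ (k + r) * (t ^ d * e₀ * b)) := by
        rw [hT, hTd]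
        change t ^ d * e₀ + -(e₀ * a) * (t ^ d * g) = _
        linear_combination (-(t ^ d * e₀)) * hab
      let U₀ : Submodule ℂ ℂ[X] := U ⊓ (Ideal.span {t ^ (d + 1)}).restrictScalars ℂ
      have hU₀ : ∀ u, u ∈ U₀ ↔ u ∈ U ∧ t ^ (d + 1) ∣ u := fun u => by
        simp [U₀, Ideal.mem_span_singleton]
      have hlt : U₀ < U := by
        refine lt_of_le_of_ne inf_le_left fun h => ?_
        rw [← h] at hvU
        exact hv ((hU₀ _).mp hvU).2
      have hfin₀ : Module.Finite ℂ U₀ := Submodule.finiteDimensional_of_le hlt.le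
      have hfr := Submodule.finrank_lt_finrank_of_lt hlt
      -- `U₀` is a complement of `v` in `U` whose elements are divisible by `t`; hence so are their
      -- images under `T`, and `U' = t⁻¹ T(U₀)`.
      let U' := (U₀.map T).comap (LinearMap.mulLeft ℂ t)
      let G : U' →ₗ[ℂ] U₀.map T := (LinearMap.mulLeft ℂ t).restrict fun x hx => hx
      have hG : Function.Injective G := by
        intro x y hxy
        have := congrArg Subtype.val hxy
        exact Subtype.ext (mul_left_cancel₀ hirr.ne_zero this)
      have hle := LinearMap.finrank_le_finrank_of_injective hG
      have hle' := Submodule.finrank_map_le T U₀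
      refine ⟨h, U', Module.Finite.of_injective G hG, by omega, fun u hu => ?_⟩
      obtain ⟨c, hc⟩ := ht
      obtain ⟨f, hf⟩ := hdiv u hu
      have hgc : g.eval c ≠ 0 := fun h0 => hg (by rw [hc]; exact dvd_iff_isRoot.mpr h0)
      set s := f.eval c / g.eval c with hs
      have hu₀ : u - s • (t ^ d * g) ∈ U₀ := by
        refine (hU₀ _).mpr ⟨U.sub_mem hu (U.smul_mem _ hvU), ?_⟩
        have e : u - s • (t ^ d * g) = t ^ d * (f - C s * g) := by
          rw [hf, smul_eq_C_mul]; ring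
        rw [e, pow_succ]
        refine mul_dvd_mul_left _ ?_
        rw [hc]
        refine dvd_iff_isRoot.mpr ?_
        simp only [IsRoot, eval_sub, eval_mul, eval_C, hs]
        field_simp
        ring
      obtain ⟨-, w₀, hw₀⟩ := (hU₀ _).mp hu₀
      have hdt : t ∣ T (u - s • (t ^ d * g)) := by
        rw [hw₀, hT, pow_succ']
        exact dvd_add (dvd_mul_right _ _) ⟨h * (t ^ d * w₀), by ring⟩
      obtain ⟨u', hu'⟩ := hdt
      refine ⟨u', ⟨_, hu₀, hu'⟩, C s * (t ^ d * e₀ * b), ?_⟩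
      have e : T u = T (u - s • (t ^ d * g)) + s • T (t ^ d * g) := by
        rw [← map_smul, ← map_add, sub_add_cancel]
      rw [← hT, e, hu', hTv, smul_eq_C_mul]
      ring
    obtain ⟨E, hE, hE1, hE2⟩ := ih k U' hfin' hU'
    have hL : ∀ v w, t * derivative v + h * v = t * w →
        (dz + mulOp (incl h / incl t)) (incl v) = incl w := by
      intro v w e
      have e' := congrArg incl e
      simp only [map_add, map_mul] at e'
      rw [dz_add_apply, dz_incl]
      field_simp
      linear_combination e'
    refine ⟨E * (dz + mulOp (incl h / incl t)), by simpa using hE.mul (hasSymbol_dz_add _),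
      fun f => ?_, fun u hu => ?_⟩
    · obtain ⟨w, hw⟩ := hE1 (C ((k + r : ℕ) + 1 : ℂ) * f + t * derivative f + h * f)
      refine ⟨w, ?_⟩
      rw [Module.End.mul_apply, hL _ _ ?_, hw]
      rw [← add_assoc, derivative_mul, derivative_pow_succ, ht']
      push_cast
      ring
    · obtain ⟨u', hu', w, e⟩ := hop u hu
      obtain ⟨w1, hw1⟩ := hE1 w
      obtain ⟨w2, hw2⟩ := hE2 u' hu'
      refine ⟨w2 + w1, ?_⟩
      rw [Module.End.mul_apply, hL _ _ e, map_add, map_add, hw1, hw2, mul_add, map_add]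

end Local

/-- For a primary subspace every symbol of large order occurs. -/
lemma hasOp_of_isPrimaryAt {t : ℂ[X]} (ht : ∃ c, t = X - C c) {V : Submodule ℂ ℂ[X]} {N : ℕ}
    (hV : ∀ f, t ^ N * f ∈ V) {n : ℕ} (hn : N ≤ n) (c : ℂ[X]) : HasOp V V n (incl c) := by
  have hm : (t ^ N).Monic := by obtain ⟨c, rfl⟩ := ht; exact (monic_X_sub_C c).pow N
  have hdeg : (t ^ N).degree = N := by
    obtain ⟨c, rfl⟩ := ht
    rw [degree_pow, degree_X_sub_C, nsmul_one]
  have ht0 : incl t ≠ 0 := by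
    apply incl_ne_zero
    obtain ⟨c, rfl⟩ := ht
    exact X_sub_C_ne_zero c
  have hrem : ∀ f : ℂ[X], f %ₘ t ^ N ∈ degreeLT ℂ N := fun f => by
    rw [mem_degreeLT, ← hdeg]
    exact degree_modByMonic_lt f hm
  have hsub : ∀ f : ℂ[X], f - f %ₘ t ^ N ∈ V := fun f => by
    have e : f - f %ₘ t ^ N = t ^ N * (f /ₘ t ^ N) := by
      rw [sub_eq_iff_eq_add', modByMonic_add_div]
    rw [e]
    exact hV _
  let S := degreeLT ℂ N
  have : FiniteDimensional ℂ S := Module.Finite.equiv (degreeLTEquiv ℂ N).symm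
  have hS : Module.finrank ℂ S = N := by
    rw [(degreeLTEquiv ℂ N).finrank_eq, Module.finrank_fin_fun]
  let F : S →ₗ[ℂ] ℂ[X] ⧸ V := V.mkQ ∘ₗ S.subtype
  have hF : Function.Surjective F := by
    intro y
    obtain ⟨f, rfl⟩ := V.mkQ_surjective y
    refine ⟨⟨_, hrem f⟩, ?_⟩
    have := hsub f
    exact ((Submodule.Quotient.eq V).mpr this).symm
  have hfin : Module.Finite ℂ (ℂ[X] ⧸ V) := Module.Finite.of_surjective F hF
  obtain ⟨k, hk⟩ : ∃ k, Module.finrank ℂ (ℂ[X] ⧸ V) = k := ⟨_, rfl⟩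
  obtain ⟨r, hr⟩ : ∃ r, Module.finrank ℂ (LinearMap.ker F) = r := ⟨_, rfl⟩
  have hkr : k + r = N := by
    have := LinearMap.finrank_range_add_finrank_ker F
    rwa [LinearMap.range_eq_top.mpr hF, finrank_top, hk, hr, hS] at this
  have hA := hasOp_top_of_finrank ht N k V hV hfin hk.le
  -- The elements of `V` of degree less than `N`. Together with `t ^ N ℂ[z]` they span `V`, so `D`
  -- maps `V` into `t ^ k ℂ[z]` and `t ^ (-k) D` is the required operator.
  let U := (LinearMap.ker F).map S.subtype
  obtain ⟨D, hD, hD1, hD2⟩ := hasOp_of_finrank ht r k U inferInstance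
    ((Submodule.finrank_map_le _ _).trans hr.le)
  have hB : HasOp V ⊤ r (incl t ^ k)⁻¹ := by
    refine ⟨mulOp (incl t ^ k)⁻¹ * D, by simpa using hD.mulOp_mul (incl t ^ k)⁻¹, fun v hv => ?_⟩
    have hu : v %ₘ t ^ N ∈ U := by
      have hvV : v %ₘ t ^ N ∈ V := by
        have := V.sub_mem hv (hsub v)
        rwa [sub_sub_cancel] at this
      exact ⟨⟨_, hrem v⟩, (Submodule.Quotient.mk_eq_zero V).mpr hvV, rfl⟩
    obtain ⟨w1, hw1⟩ := hD2 _ hu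
    obtain ⟨w2, hw2⟩ := hD1 (v /ₘ t ^ N)
    refine ⟨w1 + w2, trivial, ?_⟩
    rw [hkr] at hw2
    conv_lhs => rw [← modByMonic_add_div v (t ^ N)]
    rw [map_add, Module.End.mul_apply, map_add, hw1, hw2]
    change (incl t ^ k)⁻¹ * _ = _
    simp only [map_add, map_mul, map_pow]
    field_simp
  have hc : HasOp ⊤ ⊤ 0 (incl c) := hasOp_mul _ fun v _ => ⟨c * v, trivial, (map_mul _ _ _).symm⟩
  have h := hA.comp (hc.comp ((hasOp_dz_pow (n - N)).comp hB))
  have e1 : k + (0 + (n - N + r)) = n := by omega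
  have e2 : incl t ^ k * (incl c * (1 * (incl t ^ k)⁻¹)) = incl c := by field_simp
  rwa [e1, e2] at h

/-! ### Gluing over finitely many points -/

/-- Operators preserving two subspaces of `ℂ[z]` with disjoint supports can be glued. -/
lemma HasOp.inf {V₁ V₂ : Submodule ℂ ℂ[X]} {p₁ p₂ : ℂ[X]} (hp : IsCoprime p₁ p₂)
    (h₁ : ∀ f, p₁ * f ∈ V₁) (h₂ : ∀ f, p₂ * f ∈ V₂) {n : ℕ} {a : K} (H₁ : HasOp V₁ V₁ n a)
    (H₂ : HasOp V₂ V₂ n a) : HasOp (V₁ ⊓ V₂) (V₁ ⊓ V₂) n a := by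
  obtain ⟨D, hD, hDV⟩ := H₁
  obtain ⟨E, hE, hEV⟩ := H₂
  obtain ⟨u, w, huw⟩ := hp
  -- The weights sum to `1`, so the symbol is kept; modulo `p₁` the sum acts on `V₁ ⊓ V₂` as `D`,
  -- modulo `p₂` as `E`.
  refine ⟨mulOp (incl (w * p₂)) * D + mulOp (incl (u * p₁)) * E, ?_, fun v hv => ?_⟩
  · have h := (hD.mulOp_mul (incl (w * p₂))).add (hE.mulOp_mul (incl (u * p₁)))
    rwa [← add_mul, ← map_add, add_comm (w * p₂), huw, map_one, one_mul] at h
  · obtain ⟨x, hx, ex⟩ := hDV v hv.1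
    obtain ⟨y, hy, ey⟩ := hEV v hv.2
    refine ⟨w * p₂ * x + u * p₁ * y, ⟨?_, ?_⟩, ?_⟩
    · have e : w * p₂ * x + u * p₁ * y = x + p₁ * (u * (y - x)) := by
        linear_combination x * huw
      rw [e]
      exact V₁.add_mem hx (h₁ _)
    · have e : w * p₂ * x + u * p₁ * y = y + p₂ * (w * (x - y)) := by
        linear_combination y * huw
      rw [e]
      exact V₂.add_mem hy (h₂ _)
    · rw [LinearMap.add_apply, Module.End.mul_apply, Module.End.mul_apply, ex, ey, map_add,
        map_mul _ (w * p₂), map_mul _ (u * p₁)]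
      rfl

/-- The two claims are proved together because gluing in a new point needs the product of the
earlier factors to map `ℂ[z]` into the earlier intersection. -/
lemma hasOp_iInf {V : ℂ → Submodule ℂ ℂ[X]} {N : ℂ → ℕ}
    (hN : ∀ a f, (X - C a) ^ N a * f ∈ V a) (S : Finset ℂ) :
    (∀ f, (∏ a ∈ S, (X - C a) ^ N a) * f ∈ ⨅ a ∈ S, V a) ∧
      ∀ n, (∀ a ∈ S, N a ≤ n) → ∀ c : ℂ[X],
        HasOp (⨅ a ∈ S, V a) (⨅ a ∈ S, V a) n (incl c) := by
  classical
  induction S using Finset.induction_on with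
  | empty =>
    refine ⟨fun f => by simp, fun n _ c => ?_⟩
    have hc : HasOp ⊤ ⊤ 0 (incl c) :=
      hasOp_mul _ fun v _ => ⟨c * v, trivial, (map_mul _ _ _).symm⟩
    simpa using hc.comp (hasOp_dz_pow n)
  | insert b S hb ih =>
    rw [Finset.prod_insert hb, Finset.iInf_insert]
    refine ⟨fun f => ⟨?_, ?_⟩, fun n hn c => ?_⟩
    · rw [mul_assoc]; exact hN b _
    · rw [mul_comm (_ ^ _), mul_assoc]; exact ih.1 _
    · refine HasOp.inf ?_ (hN b) ih.1
        (hasOp_of_isPrimaryAt ⟨b, rfl⟩ (hN b) (hn b (Finset.mem_insert_self b S)) c)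
        (ih.2 n (fun a ha => hn a (Finset.mem_insert_of_mem ha)) c)
      refine IsCoprime.prod_right fun a ha => IsCoprime.pow ?_
      have hba : b ≠ a := fun h => hb (h ▸ ha)
      exact isCoprime_X_sub_C_of_isUnit_sub (sub_ne_zero.mpr hba).isUnit

/-! ### Return to `W` and finite codimension -/

/-- An element of the adelic Grassmannian, and the symbols of large order. -/
lemma exists_isLattice {W : Submodule ℂ K} (hW : W ∈ GrAd) :
    ∃ V q p n₀, IsLattice W V q p ∧ ∀ n, n₀ ≤ n → ∀ c : ℂ[X], HasOp V V n (incl c) := by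
  obtain ⟨V, hV, hfin, rfl⟩ := hW
  choose N hN using hV
  set q : K := ∏ᶠ a, incl (X - C a) ^ Module.finrank ℂ (ℂ[X] ⧸ V a) with hq
  have hq0 : q ≠ 0 := finprod_induction (· ≠ 0) one_ne_zero (fun _ _ => mul_ne_zero)
    fun a => pow_ne_zero _ (incl_ne_zero (X_sub_C_ne_zero a))
  have hinf : ⨅ a, V a = ⨅ a ∈ hfin.toFinset, V a := by
    refine le_antisymm (le_iInf fun a => le_iInf fun _ => iInf_le _ a) (le_iInf fun a => ?_)
    by_cases h : V a = ⊤
    · rw [h]; exact le_top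
    · exact iInf₂_le a (by simpa using h)
  obtain ⟨h1, h2⟩ := hasOp_iInf hN hfin.toFinset
  rw [← hinf] at h1 h2
  -- The sum serves only as a common upper bound for the exponents `N a`.
  refine ⟨⨅ a, V a, q, _, ∑ a ∈ hfin.toFinset, N a, ⟨hq0, ?_, fun w => ?_, h1⟩, fun n hn c =>
    h2 n (fun a ha => (Finset.single_le_sum (fun _ _ => Nat.zero_le _) ha).trans hn) c⟩
  · exact Finset.prod_ne_zero_iff.mpr fun a _ => pow_ne_zero _ (X_sub_C_ne_zero a)
  · constructor
    · rintro ⟨_, ⟨v, hv, rfl⟩, rfl⟩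
      exact ⟨v, hv, rfl⟩
    · rintro ⟨v, hv, rfl⟩
      exact ⟨_, ⟨v, hv, rfl⟩, rfl⟩

lemma IsLattice.exists_opOfCoeffs {W : Submodule ℂ K} {V : Submodule ℂ ℂ[X]} {q : K} {p : ℂ[X]}
    (h : IsLattice W V q p) {k : ℕ} {a : K} (H : HasOp V V k a) :
    ∃ f : ℕ → K, f k = a ∧ opOfCoeffs k f ∈ DW W := by
  obtain ⟨D, hD, hDV⟩ := H
  have hq := h.1
  have hs := (hD.mulOp_mul q⁻¹).mul_mulOp q
  have hmem := hs.mem_ratDiffOps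
  obtain ⟨f, hf, e⟩ := hs
  refine ⟨f, by rw [hf]; field_simp, ?_⟩
  rw [← e]
  refine ⟨hmem, fun w hw => ?_⟩
  obtain ⟨v, hv, rfl⟩ := (h.2.2.1 w).mp hw
  obtain ⟨u, hu, eu⟩ := hDV v hv
  refine (h.2.2.1 _).mpr ⟨u, hu, ?_⟩
  change q⁻¹ * D (q * (q⁻¹ * incl v)) = _
  rw [mul_inv_cancel_left₀ hq, eu]

/-- All symbols of order at least `n₀` occur, and below `n₀` all those divisible by `p`. So `gr`
contains the kernel of reduction of the first `n₀` coefficients modulo `p`, whose target is finite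
dimensional. -/
lemma IsLattice.finite_codim {W : Submodule ℂ K} {V : Submodule ℂ ℂ[X]} {q : K} {p : ℂ[X]}
    (h : IsLattice W V q p) {n₀ : ℕ}
    (H : ∀ n, n₀ ≤ n → ∀ c : ℂ[X], HasOp V V n (incl c)) :
    FiniteDimensional ℂ (ℂ[X][X] ⧸ (gr (DW W)).comap polyIncl.toLinearMap) := by
  set M := (gr (DW W)).comap polyIncl.toLinearMap
  have hfin : FiniteDimensional ℂ (AdjoinRoot p) := (AdjoinRoot.powerBasis h.2.1).finite
  let Φ : ℂ[X][X] →ₗ[ℂ] (Fin n₀ → AdjoinRoot p) :=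
    LinearMap.pi fun k => (AdjoinRoot.mkₐ p).toLinearMap ∘ₗ
      ((lcoeff ℂ[X] (k : ℕ)).restrictScalars ℂ)
  have hker : LinearMap.ker Φ ≤ M := by
    intro P hP
    have hP' : ∀ k, k < n₀ → p ∣ P.coeff k := fun k hk =>
      AdjoinRoot.mk_eq_zero.mp (congrFun (LinearMap.mem_ker.mp hP) ⟨k, hk⟩)
    intro k
    have e : (polyIncl P).coeff k = incl (P.coeff k) := by simp [polyIncl]
    change ∃ f : ℕ → K, f k = (polyIncl P).coeff k ∧ _
    rw [e]
    refine h.exists_opOfCoeffs ?_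
    rcases lt_or_ge k n₀ with hk | hk
    · obtain ⟨g, hg⟩ := hP' k hk
      have hm : HasOp ⊤ V 0 (incl (P.coeff k)) := hasOp_mul _ fun v _ =>
        ⟨p * (g * v), h.2.2.2 _, by rw [hg, ← map_mul, mul_assoc]⟩
      simpa using (hm.comp (hasOp_dz_pow k)).mono_left le_top
    · exact H k hk _
  have : FiniteDimensional ℂ (ℂ[X][X] ⧸ LinearMap.ker Φ) :=
    Module.Finite.equiv Φ.quotKerEquivRange.symm
  exact Module.Finite.of_surjective (Submodule.factor hker) (Submodule.factor_surjective hker)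

end AdelicGr

end

theorem proposition11p3 (W : Submodule ℂ (RatFunc ℂ)) (hW : W ∈ AdelicGr.GrAd) :
    AdelicGr.FinitenessCondition (AdelicGr.DW W) ((AdelicGr.AW W).map AdelicGr.incl) := by
  obtain ⟨V, q, p, n₀, h, H⟩ := AdelicGr.exists_isLattice hW
  exact ⟨h.isMad, h.isFramedByZ, h.gr_le, h.finite_codim H⟩
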